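/- Theorem (Constancy atoms are not safe for $\mathrm{FO}(\subseteq_1)$). *Setting.* Models have at least two elements. Signatures are relational (possibly with arbitrarily many relation symbols). A team $X$ over a model $M$ with finite domain $V$ of variables is a set of assignments $s:V\to M$. A $k$-ary first order dependency $\mathbf D$ is a first order sentence $\mathbf D(R)$ in the signature $\{R\}$, $R$ a $k$-ary relation symbol. For a set $\mathcal D$ of dependencies, formulas of $\mathrm{FO}(\mathcal D)$ are built from first order literals and dependency atoms $\mathbf D\,\bar t$ ($\mathbf D\in\mathcal D$) by $\vee,\wedge,\exists,\forall$, with (lax) team semantics: $M\models_X\alpha$ for a literal $\alpha$ iff every $s\in X$ satisfies $\alpha$; $M\models_X\mathbf D\,\bar t$ iff $(M,X(\bar t))\models\mathbf D(R)$, where $X(\bar t)=\{s(\bar t):s\in X\}$; $M\models_X\psi_1\vee\psi_2$ iff $X=Y\cup Z$ with $M\models_Y\psi_1$ and $M\models_Z\psi_2$; $M\models_X\psi_1\wedge\psi_2$ iff $M\models_X\psi_1$ and $M\models_X\psi_2$; $M\models_X\exists v\,\psi$ iff $M\models_{X[H/v]}\psi$ for some $H:X\to\mathcal P(M)\setminus\{\emptyset\}$,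 where $X[H/v]=\{s[m/v]:s\in X,\ m\in H(s)\}$; $M\models_X\forall v\,\psi$ iff $M\models_{X[M/v]}\psi$, where $X[M/v]=\{s[m/v]:s\in X,\ m\in M\}$. A sentence $\phi$ is true in $M$ iff $M\models_{\{\epsilon\}}\phi$, $\epsilon$ the empty assignment; two sentences over the same signature are equivalent iff they are true in the same models. A set $\mathcal E$ of dependencies is *safe* for $\mathcal D$ over a signature if every sentence of $\mathrm{FO}(\mathcal E\cup\mathcal D)$ over it is equivalent to some sentence of $\mathrm{FO}(\mathcal D)$ over it. Let $=\!\!(\cdot)$ be the family of constancy dependencies $\forall\bar x\bar y(R\bar x\wedge R\bar y\to\bar x=\bar y)$ of all arities, and let $\subseteq_1$ be the unary inclusion dependency $\forall uv(Ruv\to\exists w\,Rwu)$, written $x\subseteq y$ when applied to the pair $xy$. For a first order literal $\theta$, $\theta\hookrightarrow\phi$ abbreviates $\neg\theta\vee(\theta\wedge\phi)$. *Statement.* Let $L$ be any relational signature with a binary relation symbol $E$. 1. The $\mathrm{FO}(=\!\!(\cdot),\subseteq_1)$ sentence $\exists x\exists y\,(=\!\!(y)\wedge\forall z\,(Exz\hookrightarrow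 z\subseteq x)\wedge x\neq y)$ is true in an $L$-structure in which $E$ is the adjacency relation of a simple undirected graph if and only if that graph is not connected; and this sentence is not equivalent to any $\mathrm{FO}(\subseteq_1)$ sentence over $L$. 2. For $n\in\mathbb N$ let $\mathfrak A_n$ be the disjoint union of two cycles of length $2^{n+1}$ and $\mathfrak B_n$ a single cycle of length $2^{n+2}$ (a cycle of length $2$ being a single edge), regarded as $L$-structures in which $E$ is adjacency and all other relation symbols are empty. No $\mathrm{FO}(\subseteq_1)$ sentence over $L$ is true in all $\mathfrak A_n$ and false in all $\mathfrak B_n$. 3. Consequently, over $L$, constancy dependencies are not safe for $\{\subseteq_1\}$: some sentence of $\mathrm{FO}(=\!\!(\cdot),\subseteq_1)$ is not equivalent to any sentence of $\mathrm{FO}(\subseteq_1)$. The same holds for the unary constancy dependency alone. -/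

import Mathlib

open FirstOrder

universe u v w

namespace TeamSemantics

/-! ### First order dependencies -/

/-- The relation symbols of the signature `{R}` with a single `k`-ary relation symbol `R`. -/
inductive SingleRel (k : ℕ) : ℕ → Type
  | R : SingleRel k k

/-- The signature `{R}` with a single `k`-ary relation symbol `R`. -/
def relLang (k : ℕ) : FirstOrder.Language.{0, 0} where
  Functions := fun _ => Empty
  Relations := SingleRel k

/-- The symbol `R` of the signature `{R}`. -/
def relSymb (k : ℕ) : (relLang k).Relations k := SingleRel.R

/-- The `{R}`-structure `(M, S)` in which `R` is interpreted as the `k`-ary relation `S`. -/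
abbrev relStructure {M : Type w} {k : ℕ} (S : Set (Fin k → M)) : (relLang k).Structure M where
  funMap := fun f _ => Empty.elim f
  RelMap := fun {_} r => match r with
    | SingleRel.R => fun xs => xs ∈ S

/-- A first order dependency: a first order sentence `D(R)` over the signature `{R}`. -/
structure Dependency where
  arity : ℕ
  sentence : (relLang arity).Sentence

/-- `(M, S) ⊨ D(R)`. -/
def Dependency.Holds (D : Dependency) {M : Type w} (S : Set (Fin D.arity → M)) : Prop :=
  @FirstOrder.Language.Sentence.Realize (relLang D.arity) M (relStructure S) D.sentence

/-- The `k`-ary constancy dependency `∀ x̄ ȳ (R x̄ ∧ R ȳ → x̄ = ȳ)`. -/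
noncomputable def constancy (k : ℕ) : Dependency where
  arity := k
  sentence :=
    FirstOrder.Language.Formula.iAlls (α := Empty) (Fin k ⊕ Fin k)
      ((((relSymb k).formula fun i => FirstOrder.Language.Term.var (Sum.inr (Sum.inl i))) ⊓
          ((relSymb k).formula fun i => FirstOrder.Language.Term.var (Sum.inr (Sum.inr i)))) ⟹
        FirstOrder.Language.BoundedFormula.iInf fun i : Fin k =>
          FirstOrder.Language.Term.equal (FirstOrder.Language.Term.var (Sum.inr (Sum.inl i)))
            (FirstOrder.Language.Term.var (Sum.inr (Sum.inr i))))

/-- The unary inclusion dependency `∀ u v (R u v → ∃ w R w u)`;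
applied to a pair `x y` it is the atom `x ⊆ y`. -/
def unaryInclusion : Dependency where
  arity := 2
  sentence := ((relSymb 2).boundedFormula₂ (&0) (&1) ⟹
    ((relSymb 2).boundedFormula₂ (&2) (&0)).ex).all.all

theorem constancy_holds_iff (k : ℕ) {M : Type w} (S : Set (Fin k → M)) :
    (constancy k).Holds S ↔ ∀ a ∈ S, ∀ b ∈ S, a = b := by
  let _ := relStructure S
  have hR : ∀ xs : Fin k → M, FirstOrder.Language.Structure.RelMap (relSymb k) xs ↔ xs ∈ S :=
    fun xs => Iff.rfl
  change @FirstOrder.Language.Sentence.Realize (relLang k) M (relStructure S) (constancy k).sentence ↔ _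
  simp only [constancy, FirstOrder.Language.Sentence.Realize, FirstOrder.Language.Formula.realize_iAlls,
    FirstOrder.Language.Formula.realize_imp, FirstOrder.Language.Formula.realize_inf, FirstOrder.Language.Formula.realize_rel, hR]
  simp only [FirstOrder.Language.Formula.Realize, FirstOrder.Language.BoundedFormula.realize_iInf]
  constructor
  · intro h a ha b hb
    have := h (Sum.elim a b) ⟨ha, hb⟩
    funext i
    have h2 := this i
    rw [← FirstOrder.Language.Formula.Realize, FirstOrder.Language.Formula.realize_equal] at h2
    exact h2
  · rintro h i ⟨ha, hb⟩ j
    rw [← FirstOrder.Language.Formula.Realize, FirstOrder.Language.Formula.realize_equal]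
    exact congrFun (h _ ha _ hb) j

theorem unaryInclusion_holds_iff {M : Type w} (S : Set (Fin 2 → M)) :
    unaryInclusion.Holds S ↔ ∀ a b, ![a, b] ∈ S → ∃ c, ![c, a] ∈ S := by
  let _ := relStructure S
  have hR : ∀ xs : Fin 2 → M, FirstOrder.Language.Structure.RelMap (relSymb 2) xs ↔ xs ∈ S :=
    fun xs => Iff.rfl
  change @FirstOrder.Language.Sentence.Realize (relLang 2) M (relStructure S)
    unaryInclusion.sentence ↔ _
  simp only [unaryInclusion, FirstOrder.Language.Sentence.Realize, FirstOrder.Language.Formula.Realize,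
    FirstOrder.Language.BoundedFormula.realize_all, FirstOrder.Language.BoundedFormula.realize_imp,
    FirstOrder.Language.BoundedFormula.realize_ex, FirstOrder.Language.BoundedFormula.realize_rel₂, hR]
  rfl

/-! ### Formulas of `FO(𝒟)` and their team semantics -/

/-- `Fml L 𝒟 V` is the set of formulas of `FO(𝒟)` over the signature `L`, in negation normal form
and with free variables in the finite set `V`. Variables are named by natural numbers, and a
quantifier may rebind a variable that is already in `V`. -/
inductive Fml (L : FirstOrder.Language.{u, v}) (𝒟 : Set Dependency) : Finset ℕ → Type (max u v)
  | rel {V : Finset ℕ} {n : ℕ} (R : L.Relations n) (t : Fin n → L.Term V) : Fml L 𝒟 V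
  | nrel {V : Finset ℕ} {n : ℕ} (R : L.Relations n) (t : Fin n → L.Term V) : Fml L 𝒟 V
  | eq {V : Finset ℕ} (t₁ t₂ : L.Term V) : Fml L 𝒟 V
  | neq {V : Finset ℕ} (t₁ t₂ : L.Term V) : Fml L 𝒟 V
  | dep {V : Finset ℕ} (D : Dependency) (hD : D ∈ 𝒟) (t : Fin D.arity → L.Term V) : Fml L 𝒟 V
  | or {V : Finset ℕ} (φ ψ : Fml L 𝒟 V) : Fml L 𝒟 V
  | and {V : Finset ℕ} (φ ψ : Fml L 𝒟 V) : Fml L 𝒟 V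
  | ex {V : Finset ℕ} (x : ℕ) (φ : Fml L 𝒟 (insert x V)) : Fml L 𝒟 V
  | all {V : Finset ℕ} (x : ℕ) (φ : Fml L 𝒟 (insert x V)) : Fml L 𝒟 V

/-- Sentences of `FO(𝒟)`. -/
abbrev Sent (L : FirstOrder.Language.{u, v}) (𝒟 : Set Dependency) : Type (max u v) := Fml L 𝒟 ∅

/-- A team with domain `V`: a set of assignments `V → M`. -/
abbrev Team (V : Finset ℕ) (M : Type w) : Type w := Set (V → M)

/-- The assignment `s[m/x]`. -/
def assign {V : Finset ℕ} {M : Type w} (s : V → M) (x : ℕ) (m : M) :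
    ↥(insert x V) → M :=
  fun y => if h : (y : ℕ) = x then m else s ⟨y, Finset.mem_of_mem_insert_of_ne y.2 h⟩

/-- The team `X[H/x]`. -/
def supplement {V : Finset ℕ} {M : Type w} (X : Team V M) (H : (V → M) → Set M) (x : ℕ) :
    Team (insert x V) M :=
  {s' | ∃ s ∈ X, ∃ m ∈ H s, s' = assign s x m}

/-- The team `X[M/x]`. -/
def duplicate {V : Finset ℕ} {M : Type w} (X : Team V M) (x : ℕ) : Team (insert x V) M :=
  {s' | ∃ s ∈ X, ∃ m : M, s' = assign s x m}

/-- The relation `X(t̄)`. -/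
def teamRel {L : FirstOrder.Language.{u, v}} {V : Finset ℕ} {M : Type w} [L.Structure M] {k : ℕ}
    (X : Team V M) (t : Fin k → L.Term V) : Set (Fin k → M) :=
  {a | ∃ s ∈ X, a = fun i => (t i).realize s}

/-- Team semantics: `Sat φ X` is `M ⊨_X φ`. -/
def Sat {L : FirstOrder.Language.{u, v}} {𝒟 : Set Dependency} {M : Type w} [L.Structure M] :
    {V : Finset ℕ} → Fml L 𝒟 V → Team V M → Prop
  | _, .rel R t, X => ∀ s ∈ X, FirstOrder.Language.Structure.RelMap R fun i => (t i).realize s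
  | _, .nrel R t, X => ∀ s ∈ X, ¬ FirstOrder.Language.Structure.RelMap R fun i => (t i).realize s
  | _, .eq t₁ t₂, X => ∀ s ∈ X, t₁.realize s = t₂.realize s
  | _, .neq t₁ t₂, X => ∀ s ∈ X, t₁.realize s ≠ t₂.realize s
  | _, .dep D _ t, X => D.Holds (teamRel X t)
  | _, .or φ ψ, X => ∃ Y Z, X = Y ∪ Z ∧ Sat φ Y ∧ Sat ψ Z
  | _, .and φ ψ, X => Sat φ X ∧ Sat ψ X
  | _, .ex x φ, X => ∃ H, (∀ s ∈ X, (H s).Nonempty) ∧ Sat φ (supplement X H x)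
  | _, .all x φ, X => Sat φ (duplicate X x)

/-- The empty assignment `ε`. -/
def emptyAssignment (M : Type w) : ↥(∅ : Finset ℕ) → M :=
  fun x => absurd x.2 (Finset.notMem_empty _)

/-- Truth of a sentence: `M ⊨ φ` if and only if `M ⊨_{ε} φ`. -/
def Models {L : FirstOrder.Language.{u, v}} {𝒟 : Set Dependency} (M : Type w) [L.Structure M]
    (φ : Sent L 𝒟) : Prop :=
  Sat φ {emptyAssignment M}

/-- Equivalence of sentences of two logics: truth in the same models. As everywhere here, models
have at least two elements. -/
def Equivalent {L : FirstOrder.Language.{u, v}} {𝒟 𝒟' : Set Dependency} (φ : Sent L 𝒟) (ψ : Sent L 𝒟') :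
    Prop :=
  ∀ (M : Type w) [L.Structure M] [Nontrivial M], Models M φ ↔ Models M ψ

/-- `ℰ` is safe for `𝒟` over the signature `L`: every `L`-sentence of `FO(ℰ, 𝒟)` is equivalent to
some `L`-sentence of `FO(𝒟)`. -/
def Safe (L : FirstOrder.Language.{u, v}) (ℰ 𝒟 : Set Dependency) : Prop :=
  ∀ φ : Sent L (ℰ ∪ 𝒟), ∃ ψ : Sent L 𝒟, Equivalent.{u, v, w} φ ψ

/-! ### The non-connectedness sentence and the cycle graphs -/

/-- `θ ↪ φ`, that is `¬ θ ∨ (θ ∧ φ)`, for `θ` the atom `R t̄`. -/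
def relHook {L : FirstOrder.Language.{u, v}} {𝒟 : Set Dependency} {V : Finset ℕ} {n : ℕ}
    (R : L.Relations n) (t : Fin n → L.Term V) (φ : Fml L 𝒟 V) : Fml L 𝒟 V :=
  .or (.nrel R t) (.and (.rel R t) φ)

/-- The sentence `∃ x y (=(y) ∧ ∀ z (E x z ↪ z ⊆ x) ∧ x ≠ y)`, with `x, y, z` the variables
`0, 1, 2`. -/
noncomputable def nonConnected {L : FirstOrder.Language.{u, v}} {𝒟 : Set Dependency} (E : L.Relations 2)
    (hc : constancy 1 ∈ 𝒟) (hi : unaryInclusion ∈ 𝒟) : Sent L 𝒟 :=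
  .ex 0 <| .ex 1 <|
    .and (.dep (constancy 1) hc fun _ => .var ⟨1, by simp⟩) <|
      .and
        (.all 2 <| relHook E ![.var ⟨0, by simp⟩, .var ⟨2, by simp⟩] <|
          .dep unaryInclusion hi ![.var ⟨2, by simp⟩, .var ⟨0, by simp⟩])
        (.neq (.var ⟨0, by simp⟩) (.var ⟨1, by simp⟩))

/-- A graph as a structure over a relational signature: the binary symbol `E` is interpreted as
adjacency, and every other relation symbol as the empty relation. -/
abbrev graphStructure {L : FirstOrder.Language.{u, v}} [L.IsRelational] (E : L.Relations 2) {W : Type w}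
    (G : SimpleGraph W) : L.Structure W where
  funMap := fun f _ => isEmptyElim f
  RelMap := fun {n} R xs =>
    ∃ h : n = 2, h ▸ R = E ∧ G.Adj (xs (Fin.cast h.symm 0)) (xs (Fin.cast h.symm 1))

/-- The disjoint union of two cycles of length `2 ^ (n + 1)`. -/
abbrev twoCycles (n : ℕ) : SimpleGraph (Fin (2 ^ (n + 1)) ⊕ Fin (2 ^ (n + 1))) :=
  SimpleGraph.cycleGraph (2 ^ (n + 1)) ⊕g SimpleGraph.cycleGraph (2 ^ (n + 1))

/-- A single cycle of length `2 ^ (n + 2)`. -/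
abbrev oneCycle (n : ℕ) : SimpleGraph (Fin (2 ^ (n + 2))) :=
  SimpleGraph.cycleGraph (2 ^ (n + 2))

end TeamSemantics

open TeamSemantics

/-! Unary inclusion atoms carry no information on a structure whose automorphism group is transitive
on points. In a nonempty team closed under automorphisms every variable takes every value, so each
atom `x ⊆ y` holds. Such teams suffice: choosing the largest possible witnesses for `∨` and `∃`
preserves invariance, and the initial team `{ε}` is invariant. Truth of an `FO(⊆₁)` sentence is
therefore Tarskian truth with the atoms read as true (`models_iff_flat`).

A cycle and a pair of equal cycles are both transitive: they are the graphs of the step `x ↦ x + e`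
on `ZMod m` with `e = 1`, and on `ZMod 2 × ZMod m` with `e = (0, 1)`, and translations are
automorphisms. When `e` has large order a first order sentence sees only short displacements along
`e`, and an Ehrenfeucht–Fraïssé game (`LocallySimilar.forth`) shows that the two graphs agree up to
a given quantifier rank. Hence no `FO(⊆₁)` sentence separates them.

A constant, in contrast, breaks the symmetry: with `y` fixed, the values of `x` can be a
neighbour-closed set that omits `y`, which is non-connectedness (`models_nonConnected_iff`). -/

namespace TeamSemantics

open FirstOrder.Language (Term)
open FirstOrder.Language.Structure (RelMap)

variable {L : FirstOrder.Language.{u, v}}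

/-! ### Tarskian truth and back-and-forth systems -/

/-- Tarskian truth of a formula at an assignment, dependency atoms being read as true. -/
def Flat {𝒟 : Set Dependency} {M : Type*} [L.Structure M] :
    {V : Finset ℕ} → Fml L 𝒟 V → (V → M) → Prop
  | _, .rel R t, s => RelMap R fun i => (t i).realize s
  | _, .nrel R t, s => ¬ RelMap R fun i => (t i).realize s
  | _, .eq t₁ t₂, s => t₁.realize s = t₂.realize s
  | _, .neq t₁ t₂, s => t₁.realize s ≠ t₂.realize s
  | _, .dep _ _ _, _ => True
  | _, .or φ ψ, s => Flat φ s ∨ Flat ψ s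
  | _, .and φ ψ, s => Flat φ s ∧ Flat ψ s
  | _, .ex x φ, s => ∃ m, Flat φ (assign s x m)
  | _, .all x φ, s => ∀ m, Flat φ (assign s x m)

/-- Quantifier rank. -/
def Fml.rank {𝒟 : Set Dependency} : {V : Finset ℕ} → Fml L 𝒟 V → ℕ
  | _, .rel _ _ => 0
  | _, .nrel _ _ => 0
  | _, .eq _ _ => 0
  | _, .neq _ _ => 0
  | _, .dep _ _ _ => 0
  | _, .or φ ψ => max φ.rank ψ.rank
  | _, .and φ ψ => max φ.rank ψ.rank
  | _, .ex _ φ => φ.rank + 1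
  | _, .all _ φ => φ.rank + 1

theorem exists_eq_var [L.IsRelational] {α : Type*} (t : L.Term α) : ∃ x, t = Term.var x := by
  cases t with
  | var x => exact ⟨x, rfl⟩
  | func f _ => exact isEmptyElim f

/-- Assignments related by a back-and-forth system satisfy the same formulas, up to the quantifier
rank that the system allows. -/
theorem flat_iff_of_backAndForth [L.IsRelational] {𝒟 : Set Dependency} {A B : Type*}
    [L.Structure A] [L.Structure B] (P : ∀ V : Finset ℕ, ℕ → (V → A) → (V → B) → Prop)
    (hrel : ∀ {V m a b}, P V m a b → ∀ {n} (R : L.Relations n) (x : Fin n → V),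
      RelMap R (fun i => a (x i)) ↔ RelMap R (fun i => b (x i)))
    (heq : ∀ {V m a b}, P V m a b → ∀ i j, a i = a j ↔ b i = b j)
    (forth : ∀ {V m a b}, P V (m + 1) a b → ∀ x c, ∃ d, P (insert x V) m (assign a x c) (assign b x d))
    (back : ∀ {V m a b}, P V (m + 1) a b → ∀ x d, ∃ c, P (insert x V) m (assign a x c) (assign b x d))
    {V : Finset ℕ} (φ : Fml L 𝒟 V) :
    ∀ {m a b}, φ.rank ≤ m → P V m a b → (Flat φ a ↔ Flat φ b) := by
  induction φ with
  | rel R t =>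
    intro m a b _ h
    choose x hx using fun i => exists_eq_var (t i)
    simpa [Flat, hx] using hrel h R x
  | nrel R t =>
    intro m a b _ h
    choose x hx using fun i => exists_eq_var (t i)
    simpa [Flat, hx] using not_congr (hrel h R x)
  | eq t₁ t₂ =>
    intro m a b _ h
    obtain ⟨i, rfl⟩ := exists_eq_var t₁
    obtain ⟨j, rfl⟩ := exists_eq_var t₂
    simpa [Flat] using heq h i j
  | neq t₁ t₂ =>
    intro m a b _ h
    obtain ⟨i, rfl⟩ := exists_eq_var t₁
    obtain ⟨j, rfl⟩ := exists_eq_var t₂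
    simpa [Flat] using not_congr (heq h i j)
  | dep D hD t => simp [Flat]
  | or φ ψ ihφ ihψ =>
    intro m a b hm h
    simp only [Fml.rank, max_le_iff] at hm
    exact or_congr (ihφ hm.1 h) (ihψ hm.2 h)
  | and φ ψ ihφ ihψ =>
    intro m a b hm h
    simp only [Fml.rank, max_le_iff] at hm
    exact and_congr (ihφ hm.1 h) (ihψ hm.2 h)
  | ex x φ ih =>
    intro m a b hm h
    obtain _ | m := m
    · simp [Fml.rank] at hm
    have hm := Nat.le_of_succ_le_succ hm
    constructor
    · rintro ⟨c, hc⟩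
      obtain ⟨d, hd⟩ := forth h x c
      exact ⟨d, (ih hm hd).1 hc⟩
    · rintro ⟨d, hd⟩
      obtain ⟨c, hc⟩ := back h x d
      exact ⟨c, (ih hm hc).2 hd⟩
  | all x φ ih =>
    intro m a b hm h
    obtain _ | m := m
    · simp [Fml.rank] at hm
    have hm := Nat.le_of_succ_le_succ hm
    constructor
    · intro H d
      obtain ⟨c, hc⟩ := back h x d
      exact (ih hm hc).1 (H c)
    · intro H c
      obtain ⟨d, hd⟩ := forth h x c
      exact (ih hm hd).2 (H d)

theorem comp_assign {V : Finset ℕ} {M N : Type*} (g : M → N) (s : V → M) (x : ℕ) (m : M) :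
    g ∘ assign s x m = assign (g ∘ s) x (g m) := by
  funext y
  simp only [Function.comp, assign]
  split_ifs <;> rfl

/-- Tarskian truth is invariant under automorphisms. -/
theorem flat_comp_equiv [L.IsRelational] {𝒟 : Set Dependency} {M : Type*} [L.Structure M]
    (g : M ≃[L] M) {V : Finset ℕ} (φ : Fml L 𝒟 V) (s : V → M) : Flat φ (g ∘ s) ↔ Flat φ s := by
  -- The relation `b = g ∘ a` is a back-and-forth system of unlimited rank, so the index `m` is
  -- ignored.
  refine (flat_iff_of_backAndForth (fun V _ a b => b = g ∘ a) ?_ ?_ ?_ ?_ φ le_rfl rfl).symm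
  · rintro V m a _ rfl n R x
    exact (g.map_rel R _).symm
  · rintro V m a _ rfl i j
    simp
  · rintro V m a _ rfl x c
    exact ⟨g c, (comp_assign _ _ _ _).symm⟩
  · rintro V m a _ rfl x d
    refine ⟨g.symm d, ?_⟩
    simp [comp_assign]

/-! ### Unary inclusion atoms are trivial on invariant teams of transitive structures -/

/-- Every two elements are exchanged by some automorphism. -/
def Homogeneous (L : FirstOrder.Language.{u, v}) (M : Type*) [L.Structure M] : Prop :=
  ∀ a b : M, ∃ g : M ≃[L] M, g a = b

/-- A team invariant under all automorphisms. -/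
def InvariantTeam (L : FirstOrder.Language.{u, v}) {M : Type*} [L.Structure M] {V : Finset ℕ}
    (X : Team V M) : Prop :=
  ∀ (g : M ≃[L] M), ∀ s ∈ X, g ∘ s ∈ X

/-- Reading dependency atoms as true only weakens the formula, and the other clauses can be checked
one assignment at a time. No symmetry is needed in this direction. -/
theorem flat_of_sat {𝒟 : Set Dependency} {M : Type*} [L.Structure M] {V : Finset ℕ}
    (φ : Fml L 𝒟 V) : ∀ {X : Team V M}, Sat φ X → ∀ s ∈ X, Flat φ s := by
  induction φ with
  | rel R t => exact fun h => h
  | nrel R t => exact fun h => h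
  | eq t₁ t₂ => exact fun h => h
  | neq t₁ t₂ => exact fun h => h
  | dep D hD t => exact fun _ _ _ => trivial
  | or φ ψ ihφ ihψ =>
    rintro _ ⟨Y, Z, rfl, hY, hZ⟩ s (hs | hs)
    · exact Or.inl (ihφ hY s hs)
    · exact Or.inr (ihψ hZ s hs)
  | and φ ψ ihφ ihψ => exact fun h s hs => ⟨ihφ h.1 s hs, ihψ h.2 s hs⟩
  | ex x φ ih =>
    rintro X ⟨H, hne, h⟩ s hs
    obtain ⟨m, hm⟩ := hne s hs
    exact ⟨m, ih h _ ⟨s, hs, m, hm, rfl⟩⟩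
  | all x φ ih => exact fun h s hs m => ih h _ ⟨s, hs, m, rfl⟩

/-- The witnesses for `∨` and `∃` are taken as large as Tarskian truth permits. They are then
preserved by automorphisms, so the induction only meets invariant teams. -/
theorem sat_of_flat [L.IsRelational] {M : Type*} [L.Structure M] (hM : Homogeneous L M)
    {V : Finset ℕ} (φ : Fml L {unaryInclusion} V) :
    ∀ {X : Team V M}, InvariantTeam L X → (∀ s ∈ X, Flat φ s) → Sat φ X := by
  induction φ with
  | rel R t => exact fun _ h => h
  | nrel R t => exact fun _ h => h
  | eq t₁ t₂ => exact fun _ h => h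
  | neq t₁ t₂ => exact fun _ h => h
  | dep D hD t =>
    intro X hX _
    obtain rfl : D = unaryInclusion := hD
    refine (unaryInclusion_holds_iff _).2 ?_
    rintro a b ⟨s, hs, hab⟩
    obtain ⟨x, hx⟩ := exists_eq_var (t (1 : Fin 2))
    -- Transitivity moves the value of the right-hand variable to `a`; invariance keeps the moved
    -- assignment in the team.
    obtain ⟨g, hg⟩ := hM (s x) a
    refine ⟨(t (0 : Fin 2)).realize (g ∘ s), g ∘ s, hX g s hs, ?_⟩
    funext i
    refine Fin.cases rfl (fun i => ?_) i
    obtain rfl : i = 0 := Subsingleton.elim _ _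
    change a = (t (1 : Fin 2)).realize (g ∘ s)
    rw [hx]
    exact hg.symm
  | or φ ψ ihφ ihψ =>
    intro X hX h
    refine ⟨{s ∈ X | Flat φ s}, {s ∈ X | Flat ψ s}, ?_, ihφ ?_ fun s hs => hs.2,
      ihψ ?_ fun s hs => hs.2⟩
    · ext s
      simp only [Set.mem_union, Set.mem_ofPred_eq, ← and_or_left]
      exact ⟨fun hs => ⟨hs, h s hs⟩, fun hs => hs.1⟩
    · exact fun g s hs => ⟨hX g s hs.1, (flat_comp_equiv g φ s).2 hs.2⟩
    · exact fun g s hs => ⟨hX g s hs.1, (flat_comp_equiv g ψ s).2 hs.2⟩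
  | and φ ψ ihφ ihψ =>
    exact fun hX h => ⟨ihφ hX fun s hs => (h s hs).1, ihψ hX fun s hs => (h s hs).2⟩
  | ex x φ ih =>
    intro X hX h
    refine ⟨fun s => {m | Flat φ (assign s x m)}, fun s hs => h s hs, ih ?_ ?_⟩
    · rintro g _ ⟨s, hs, m, hm, rfl⟩
      refine ⟨g ∘ s, hX g s hs, g m, ?_, comp_assign _ _ _ _⟩
      rw [Set.mem_ofPred_eq, ← comp_assign]
      exact (flat_comp_equiv g φ _).2 hm
    · rintro _ ⟨s, hs, m, hm, rfl⟩
      exact hm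
  | all x φ ih =>
    intro X hX h
    refine ih ?_ ?_
    · rintro g _ ⟨s, hs, m, rfl⟩
      exact ⟨g ∘ s, hX g s hs, g m, comp_assign _ _ _ _⟩
    · rintro _ ⟨s, hs, m, rfl⟩
      exact h s hs m

theorem models_iff_flat [L.IsRelational] {M : Type*} [L.Structure M] (hM : Homogeneous L M)
    (φ : Sent L {unaryInclusion}) : Models M φ ↔ Flat φ (emptyAssignment M) := by
  constructor
  · exact fun h => flat_of_sat φ h _ rfl
  · intro h
    refine sat_of_flat hM φ ?_ ?_
    · rintro g s -
      exact funext fun x => absurd x.2 (Finset.notMem_empty _)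
    · rintro s rfl
      exact h

/-! ### Cayley graphs of a single generator -/

/-- `M` is, through the coordinates `p`, the Cayley graph of the abelian group `G` with the single
generator `e`, in which the symbols other than `E` are empty. -/
def IsCayley (E : L.Relations 2) {M G : Type*} [L.Structure M] [AddCommGroup G] (p : M ≃ G)
    (e : G) : Prop :=
  ∀ {n : ℕ} (R : L.Relations n) (xs : Fin n → M), RelMap R xs ↔
    ∃ h : n = 2, h ▸ R = E ∧
      (p (xs (Fin.cast h.symm 1)) = p (xs (Fin.cast h.symm 0)) + e ∨
        p (xs (Fin.cast h.symm 0)) = p (xs (Fin.cast h.symm 1)) + e)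

/-- Translation by `p b - p a` commutes with adding `e`. -/
theorem IsCayley.homogeneous [L.IsRelational] {E : L.Relations 2} {M G : Type*} [L.Structure M]
    [AddCommGroup G] {p : M ≃ G} {e : G} (hp : IsCayley E p e) : Homogeneous L M := by
  intro a b
  refine ⟨⟨(p.trans (Equiv.addRight (p b - p a))).trans p.symm, fun f => isEmptyElim f, ?_⟩, ?_⟩
  · intro n R xs
    rw [hp, hp]
    simp [add_right_comm _ _ e]
  · change p.symm (p a + (p b - p a)) = b
    simp

/-- Assignments with the same differences, as far as small multiples of the generators go. -/
def LocallySimilar {A B G G' : Type*} [AddCommGroup G] [AddCommGroup G'] (p : A ≃ G) (e : G)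
    (q : B ≃ G') (e' : G') (K : ℕ) (V : Finset ℕ) (m : ℕ) (a : V → A) (b : V → B) : Prop :=
  V.card + m ≤ K ∧ ∀ (i j : V) (k : ℤ), |k| ≤ 2 ^ m →
    (p (a j) = p (a i) + k • e ↔ q (b j) = q (b i) + k • e')

theorem zsmul_eq_zero_iff_of_abs_lt {G : Type*} [AddCommGroup G] {e : G} {k : ℤ}
    (hk : |k| < addOrderOf e) : k • e = 0 ↔ k = 0 := by
  refine ⟨fun h => ?_, fun h => by simp [h]⟩
  exact Int.eq_zero_of_abs_lt_dvd (addOrderOf_dvd_iff_zsmul_eq_zero.2 h) hk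

section LocallySimilar

variable {A B G G' : Type*} [AddCommGroup G] [AddCommGroup G'] {p : A ≃ G} {e : G}
  {q : B ≃ G'} {e' : G'} {K : ℕ}

theorem LocallySimilar.symm {V : Finset ℕ} {m : ℕ} {a : V → A} {b : V → B}
    (h : LocallySimilar p e q e' K V m a b) : LocallySimilar q e' p e K V m b a :=
  ⟨h.1, fun i j k hk => (h.2 i j k hk).symm⟩

/-- Only pairs involving the new point are at issue: `hcd` handles new against old in both
directions, by negating `k`, and `hself` the new point against itself. Old pairs inherit the
condition from the larger radius. -/
theorem LocallySimilar.assign {V : Finset ℕ} {m : ℕ} {a : V → A} {b : V → B}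
    (h : LocallySimilar p e q e' K V (m + 1) a b) (x : ℕ) {c : A} {d : B}
    (hcd : ∀ (i : V) (k : ℤ), |k| ≤ 2 ^ m → (p c = p (a i) + k • e ↔ q d = q (b i) + k • e'))
    (hself : ∀ k : ℤ, |k| ≤ 2 ^ m → (k • e = 0 ↔ k • e' = 0)) :
    LocallySimilar p e q e' K (insert x V) m (assign a x c) (assign b x d) := by
  refine ⟨?_, fun i j k hk => ?_⟩
  · have := Finset.card_insert_le x V
    have := h.1
    omega
  · have hle : (2 : ℤ) ^ m ≤ 2 ^ (m + 1) := pow_le_pow_right₀ (by norm_num) (Nat.le_succ m)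
    unfold TeamSemantics.assign
    split_ifs with hj hi hi
    · simpa using hself k hk
    · exact hcd _ k hk
    · have := hcd ⟨j, Finset.mem_of_mem_insert_of_ne j.2 hj⟩ (-k) (by rwa [abs_neg])
      simpa [← sub_eq_add_neg, eq_sub_iff_add_eq, eq_comm] using this
    · exact h.2 _ _ k (hk.trans hle)

/-- A point within `2 ^ m` steps of some earlier one is answered by the same displacement; a point
far from all of them is answered by any far point, which exists by counting. The radius halves at
each move because two displacements of size at most `2 ^ m` differ by at most `2 ^ (m + 1)`. -/
theorem LocallySimilar.forth [Finite G'] {V : Finset ℕ} {m : ℕ}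
    {a : V → A} {b : V → B} (h : LocallySimilar p e q e' K V (m + 1) a b)
    (hG : 2 ^ K * (K + 1) * 3 < addOrderOf e) (hG' : 2 ^ K * (K + 1) * 3 < addOrderOf e')
    (x : ℕ) (c : A) :
    ∃ d, LocallySimilar p e q e' K (insert x V) m (TeamSemantics.assign a x c)
      (TeamSemantics.assign b x d) := by
  have hcard := h.1
  have hmK : 2 ^ m ≤ 2 ^ K := Nat.pow_le_pow_right (by norm_num) (by omega)
  have hbound : 2 ^ m ≤ 2 ^ K * (K + 1) * 3 := by nlinarith [Nat.zero_le (2 ^ K * K)]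
  have hself : ∀ k : ℤ, |k| ≤ 2 ^ m → (k • e = 0 ↔ k • e' = 0) := by
    intro k hk
    have hk' : |k| ≤ ((2 ^ K * (K + 1) * 3 : ℕ) : ℤ) := hk.trans (by exact_mod_cast hbound)
    rw [zsmul_eq_zero_iff_of_abs_lt (hk'.trans_lt (by exact_mod_cast hG)),
      zsmul_eq_zero_iff_of_abs_lt (hk'.trans_lt (by exact_mod_cast hG'))]
  by_cases hc : ∃ (i : V) (k : ℤ), |k| ≤ 2 ^ m ∧ p c = p (a i) + k • e
  · obtain ⟨i, k, hk, hpc⟩ := hc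
    refine ⟨q.symm (q (b i) + k • e'), h.assign x (fun j l hl => ?_) hself⟩
    have hkl : |l - k| ≤ 2 ^ (m + 1) := by
      rw [pow_succ]
      exact (abs_sub l k).trans (by linarith)
    have := h.2 j i (l - k) hkl
    rw [hpc, Equiv.apply_symm_apply]
    rw [sub_smul, sub_smul, add_sub, add_sub, eq_sub_iff_add_eq, eq_sub_iff_add_eq] at this
    exact this
  · push Not at hc
    classical
    have := Fintype.ofFinite G'
    -- The forbidden answers: the balls of radius `2 ^ m` along `e'` around the points already
    -- played. There are at most `K` balls, each with at most `2 * 2 ^ m + 1 ≤ 3 * 2 ^ K` points,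
    -- whence the bound on the order of `e'`.
    let S : Finset G' := (Finset.univ ×ˢ Finset.Icc (-2 ^ m : ℤ) (2 ^ m)).image
      fun z : V × ℤ => q (b z.1) + z.2 • e'
    have hS : S.card < (Finset.univ : Finset G').card := by
      have h1 : S.card ≤ V.card * (2 * 2 ^ m + 1) := by
        refine Finset.card_image_le.trans ?_
        rw [Finset.card_product, Int.card_Icc, Finset.card_univ, Fintype.card_coe]
        refine Nat.mul_le_mul_left _ ?_
        rw [Int.toNat_le]
        push_cast
        linarith
      have h2 : addOrderOf e' ≤ (Finset.univ : Finset G').card := by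
        rw [Finset.card_univ]
        exact addOrderOf_le_card_univ
      have h3 : V.card * (2 * 2 ^ m + 1) ≤ (K + 1) * (2 ^ K * 3) := by
        refine Nat.mul_le_mul (by omega) ?_
        have := Nat.one_le_two_pow (n := K)
        omega
      calc S.card ≤ (K + 1) * (2 ^ K * 3) := h1.trans h3
        _ = 2 ^ K * (K + 1) * 3 := by ring
        _ < _ := hG'.trans_le h2
    obtain ⟨y, -, hy⟩ := Finset.exists_mem_notMem_of_card_lt_card hS
    refine ⟨q.symm y, h.assign x (fun i k hk => ?_) hself⟩
    refine iff_of_false (hc i k hk) fun hyk => hy ?_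
    rw [Equiv.apply_symm_apply] at hyk
    exact Finset.mem_image.2 ⟨(i, k), by simpa [abs_le] using hk, hyk.symm⟩

end LocallySimilar

/-- Cayley graphs of generators of large order satisfy the same `FO(⊆₁)` sentences of bounded
quantifier rank. -/
theorem IsCayley.models_iff [L.IsRelational] {E : L.Relations 2} {A B G G' : Type*}
    [L.Structure A] [L.Structure B] [AddCommGroup G] [AddCommGroup G'] [Finite G] [Finite G']
    {p : A ≃ G} {e : G} {q : B ≃ G'} {e' : G'} (hp : IsCayley E p e) (hq : IsCayley E q e')
    (ψ : Sent L {unaryInclusion}) (hG : 2 ^ ψ.rank * (ψ.rank + 1) * 3 < addOrderOf e)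
    (hG' : 2 ^ ψ.rank * (ψ.rank + 1) * 3 < addOrderOf e') : Models A ψ ↔ Models B ψ := by
  rw [models_iff_flat hp.homogeneous, models_iff_flat hq.homogeneous]
  refine flat_iff_of_backAndForth (LocallySimilar p e q e' ψ.rank) ?_ ?_ ?_ ?_ ψ le_rfl
    ⟨by simp, fun i => absurd i.2 (Finset.notMem_empty _)⟩
  · intro V m a b h n R x
    rw [hp, hq]
    -- Adjacency is displacement `1`, and equality below is displacement `0`; both lie within the
    -- radius `2 ^ m` even when `m = 0`.
    have key : ∀ i j, p (a j) = p (a i) + e ↔ q (b j) = q (b i) + e' := fun i j => by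
      simpa using h.2 i j 1 (by simpa using one_le_pow₀ (by norm_num : (1 : ℤ) ≤ 2))
    simp only [key]
  · intro V m a b h i j
    simpa using h.2 j i 0 (by simp)
  · exact fun h x c => h.forth hG hG' x c
  · intro V m a b h x d
    obtain ⟨c, hc⟩ := h.symm.forth hG' hG x d
    exact ⟨c, hc.symm⟩

/-! ### Cycles as Cayley graphs -/

/-- The bound on `m` is needed: for `m = 1` the right-hand side would give a loop, and `ZMod 0` is
infinite. -/
theorem cycleGraph_adj_iff_zmod {m : ℕ} (hm : 2 ≤ m) : ∃ p : Fin m ≃ ZMod m, ∀ x y,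
    (SimpleGraph.cycleGraph m).Adj x y ↔ p y = p x + 1 ∨ p x = p y + 1 := by
  obtain ⟨k, rfl⟩ := Nat.exists_eq_add_of_le' hm
  refine ⟨Equiv.refl (Fin (k + 2)), fun x y => ?_⟩
  rw [SimpleGraph.cycleGraph_adj, or_comm]
  exact or_congr sub_eq_iff_eq_add' (sub_eq_iff_eq_add')

/-- The element `(0, 1)` does not generate the group; the two cosets of its multiples are the two
cycles. -/
theorem sum_cycleGraph_adj_iff_zmod {m : ℕ} (hm : 2 ≤ m) :
    ∃ p : Fin m ⊕ Fin m ≃ ZMod 2 × ZMod m, ∀ x y,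
      (SimpleGraph.cycleGraph m ⊕g SimpleGraph.cycleGraph m).Adj x y ↔
        p y = p x + (0, 1) ∨ p x = p y + (0, 1) := by
  obtain ⟨p, hp⟩ := cycleGraph_adj_iff_zmod hm
  let b : Bool ≃ ZMod 2 := finTwoEquiv.symm
  have hb : b false ≠ b true := b.injective.ne (by simp)
  refine ⟨(Equiv.boolProdEquivSum (Fin m)).symm.trans (b.prodCongr p), ?_⟩
  rintro (x | x) (y | y) <;> simp [hp, Prod.ext_iff, hb, hb.symm]

theorem isCayley_graphStructure [L.IsRelational] (E : L.Relations 2) {W Γ : Type*}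
    [AddCommGroup Γ] {G : SimpleGraph W} {p : W ≃ Γ} {e : Γ}
    (h : ∀ x y, G.Adj x y ↔ p y = p x + e ∨ p x = p y + e) :
    @IsCayley L E W Γ (graphStructure E G) _ p e := by
  intro n R xs
  simp only [← h]
  rfl

/-- Every `FO(⊆₁)` sentence fails to separate some pair of cycles from the single cycle on as many
vertices. -/
theorem exists_models_twoCycles_iff_oneCycle [L.IsRelational] (E : L.Relations 2)
    (ψ : Sent L {unaryInclusion}) :
    ∃ n : ℕ, ∀ {A B : Type w} (f : A ≃ Fin (2 ^ (n + 1)) ⊕ Fin (2 ^ (n + 1)))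
      (g : B ≃ Fin (2 ^ (n + 2))),
      @Models L _ A (graphStructure E ((twoCycles n).comap f)) ψ ↔
        @Models L _ B (graphStructure E ((oneCycle n).comap g)) ψ := by
  -- The bound required by the game for the rank of `ψ`; the orders `2 ^ (n + 1)` and `2 ^ (n + 2)`
  -- exceed it.
  let n := 2 ^ ψ.rank * (ψ.rank + 1) * 3
  have hn : n < 2 ^ (n + 1) := (Nat.lt_succ_self n).trans Nat.lt_two_pow_self
  have hn' : n < 2 ^ (n + 2) := hn.trans (Nat.pow_lt_pow_right (by norm_num) (by omega))
  have two_le : ∀ k, 2 ≤ 2 ^ (k + 1) := fun k => Nat.le_self_pow (by omega) 2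
  obtain ⟨p, hp⟩ := sum_cycleGraph_adj_iff_zmod (two_le n)
  obtain ⟨q, hq⟩ := cycleGraph_adj_iff_zmod (two_le (n + 1))
  have : NeZero (2 ^ (n + 1)) := ⟨by positivity⟩
  have : NeZero (2 ^ (n + 2)) := ⟨by positivity⟩
  refine ⟨n, fun {A B} f g => ?_⟩
  let _ : L.Structure A := graphStructure E ((twoCycles n).comap f)
  let _ : L.Structure B := graphStructure E ((oneCycle n).comap g)
  have hA : IsCayley E (f.trans p) (0, 1) :=
    isCayley_graphStructure E (G := (twoCycles n).comap f) (p := f.trans p) (e := (0, 1)) fun x y => hp (f x) (f y)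
  have hB : IsCayley E (g.trans q) 1 :=
    isCayley_graphStructure E (G := (oneCycle n).comap g) (p := g.trans q) (e := 1) fun x y => hq (g x) (g y)
  refine hA.models_iff hB ψ ?_ ?_
  · rw [Prod.addOrderOf_mk, addOrderOf_zero, ZMod.addOrderOf_one, Nat.lcm_one_left]
    exact hn
  · rw [ZMod.addOrderOf_one]
    exact hn'

/-! ### The non-connectedness sentence -/

theorem constancy_one_holds_teamRel_iff {M : Type*}
    [L.Structure M] {V : Finset ℕ} (i : V) (X : Team V M) :
    (constancy 1).Holds (teamRel (L := L) X fun _ => .var i) ↔ ∀ s ∈ X, ∀ s' ∈ X, s i = s' i := by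
  refine (constancy_holds_iff 1 _).trans ⟨fun h s hs s' hs' => ?_, ?_⟩
  · exact congrFun (h _ ⟨s, hs, rfl⟩ _ ⟨s', hs', rfl⟩) (0 : Fin 1)
  · rintro h _ ⟨s, hs, rfl⟩ _ ⟨s', hs', rfl⟩
    exact funext fun _ => h s hs s' hs'

theorem unaryInclusion_holds_teamRel_iff {M : Type*}
    [L.Structure M] {V : Finset ℕ} (i j : V) (X : Team V M) :
    unaryInclusion.Holds (teamRel (L := L) X ![.var i, .var j]) ↔
      ∀ s ∈ X, ∃ s' ∈ X, s' j = s i := by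
  refine (unaryInclusion_holds_iff _).trans ⟨fun h s hs => ?_, ?_⟩
  · obtain ⟨c, s', hs', hc⟩ := h (s i) (s j) ⟨s, hs, by funext k; fin_cases k <;> rfl⟩
    exact ⟨s', hs', (congrFun hc (1 : Fin 2)).symm⟩
  · rintro h a b ⟨s, hs, hab⟩
    obtain ⟨s', hs', hj⟩ := h s hs
    obtain rfl : a = s i := congrFun hab (0 : Fin 2)
    refine ⟨s' i, s', hs', ?_⟩
    funext k
    fin_cases k
    · rfl
    · exact hj.symm

/-- The inclusion atom makes the set of values of `x` closed under neighbours, so it contains the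
component of each of its points, while `x ≠ y` excludes the constant value of `y`. Conversely, `x`
ranges over the component of `a` and `y` is a point `b` outside it. -/
theorem models_nonConnected_iff {𝒟 : Set Dependency} (E : L.Relations 2) (hc : constancy 1 ∈ 𝒟)
    (hi : unaryInclusion ∈ 𝒟) (M : Type w) [L.Structure M] [Nonempty M] (G : SimpleGraph M)
    (hG : ∀ a b : M, RelMap E ![a, b] ↔ G.Adj a b) :
    Models M (nonConnected E hc hi) ↔ ¬ G.Connected := by
  have hvec : ∀ {V : Finset ℕ} (s : V → M) (i j : V),
      (fun k => ((![Term.var i, Term.var j] : Fin 2 → L.Term V) k).realize s) = ![s i, s j] := by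
    intro V s i j
    funext k
    fin_cases k <;> rfl
  simp only [Models, nonConnected, relHook, Sat, hvec, hG, Term.realize_var]
  constructor
  · rintro ⟨H, hH, H', hH', hconst, ⟨Y, Z, hYZ, hY, hZ, hincl⟩, hne⟩ hconn
    replace hconst := (constancy_one_holds_teamRel_iff _ _).1 hconst
    replace hincl := (unaryInclusion_holds_teamRel_iff _ _ _).1 hincl
    obtain ⟨a, ha⟩ := hH _ rfl
    obtain ⟨b, hb⟩ := hH' _ ⟨_, rfl, a, ha, rfl⟩
    set X := supplement (supplement {emptyAssignment M} H 0) H' 1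
    have hs₀ : assign (assign (emptyAssignment M) 0 a) 1 b ∈ X := ⟨_, ⟨_, rfl, a, ha, rfl⟩, b, hb, rfl⟩
    have hreach : ∀ c, G.Reachable a c → ∃ s ∈ X, s ⟨0, by simp⟩ = c := by
      intro c hac
      rw [SimpleGraph.reachable_iff_reflTransGen] at hac
      induction hac with
      | refl => exact ⟨_, hs₀, rfl⟩
      | @tail c d _ hcd ih =>
        obtain ⟨s, hs, rfl⟩ := ih
        -- Since `d` is a neighbour of the value of `x`, this assignment cannot lie in the half
        -- where `E x z` fails; the inclusion atom on the other half makes `d` a value of `x`.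
        have hsd : assign s 2 d ∈ Y ∪ Z := hYZ ▸ ⟨s, hs, d, rfl⟩
        rcases hsd with h | h
        · exact absurd hcd (hY _ h)
        · obtain ⟨t, ht, hct⟩ := hincl _ h
          obtain ⟨s', hs', m, rfl⟩ : t ∈ duplicate X 2 := hYZ ▸ Or.inr ht
          exact ⟨s', hs', hct⟩
    obtain ⟨s, hs, hsb⟩ := hreach b (hconn.preconnected a b)
    refine hne s hs (hsb.trans ?_)
    exact hconst _ hs₀ s hs
  · intro hconn
    have hpre : ¬ G.Preconnected := fun h => hconn ⟨h⟩
    simp only [SimpleGraph.Preconnected, not_forall] at hpre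
    obtain ⟨a, b, hab⟩ := hpre
    refine ⟨fun _ => {c | G.Reachable a c}, fun _ _ => ⟨a, .refl a⟩, fun _ => {b},
      fun _ _ => ⟨b, rfl⟩, (constancy_one_holds_teamRel_iff _ _).2 ?_, ?_, ?_⟩
    · rintro _ ⟨_, ⟨_, -, _, -, rfl⟩, _, rfl, rfl⟩ _ ⟨_, ⟨_, -, _, -, rfl⟩, _, rfl, rfl⟩
      rfl
    · set X := supplement (supplement {emptyAssignment M} (fun _ => {c | G.Reachable a c}) 0)
        (fun _ => {b}) 1
      have hX : ∀ c, G.Reachable a c → assign (assign (emptyAssignment M) 0 c) 1 b ∈ X :=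
        fun c hc => ⟨_, ⟨_, rfl, c, hc, rfl⟩, b, rfl, rfl⟩
      refine ⟨{s ∈ duplicate X 2 | ¬ G.Adj (s ⟨0, by simp⟩) (s ⟨2, by simp⟩)},
        {s ∈ duplicate X 2 | G.Adj (s ⟨0, by simp⟩) (s ⟨2, by simp⟩)}, ?_, fun s hs => hs.2,
        fun s hs => hs.2, (unaryInclusion_holds_teamRel_iff _ _ _).2 ?_⟩
      · ext s
        simp only [Set.mem_union, Set.mem_ofPred_eq, ← and_or_left]
        exact ⟨fun hs => ⟨hs, (em _).symm⟩, fun hs => hs.1⟩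
      · rintro _ ⟨⟨_, ⟨_, ⟨_, -, c, hc', rfl⟩, b, rfl, rfl⟩, d, rfl⟩, hadj⟩
        replace hadj : G.Adj c d := hadj
        -- The witness for `z ⊆ x` must itself satisfy `E x z`; the reversed edge, with `x = d` and
        -- `z = c`, does so by symmetry.
        refine ⟨assign (assign (assign (emptyAssignment M) 0 d) 1 b) 2 c,
          ⟨⟨_, hX d ?_, c, rfl⟩, hadj.symm⟩, rfl⟩
        exact SimpleGraph.Reachable.trans hc' hadj.reachable
    · rintro _ ⟨_, ⟨_, -, c, hc, rfl⟩, b, rfl, rfl⟩ hcb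
      obtain rfl : c = b := hcb
      exact hab hc

/-- Non-connectedness is not expressible in `FO(⊆₁)`. -/
theorem not_equivalent_nonConnected [L.IsRelational] {𝒟 : Set Dependency} (E : L.Relations 2)
    (hc : constancy 1 ∈ 𝒟) (hi : unaryInclusion ∈ 𝒟) (ψ : Sent L {unaryInclusion}) :
    ¬ Equivalent.{u, v, w} (nonConnected E hc hi) ψ := by
  intro h
  obtain ⟨n, hn⟩ := exists_models_twoCycles_iff_oneCycle.{u, v, w} E ψ
  -- Equivalence quantifies over models in the universe `w`, so the cycles are lifted there.
  let f : ULift.{w} (Fin (2 ^ (n + 1)) ⊕ Fin (2 ^ (n + 1))) ≃ _ := Equiv.ulift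
  let g : ULift.{w} (Fin (2 ^ (n + 2))) ≃ _ := Equiv.ulift
  have hrel : ∀ {W : Type w} (G : SimpleGraph W) (a b : W),
      @RelMap L W (graphStructure E G) 2 E ![a, b] ↔ G.Adj a b := by
    intro W G a b
    exact ⟨fun ⟨_, _, hab⟩ => hab, fun hab => ⟨rfl, rfl, hab⟩⟩
  have : NeZero (2 ^ (n + 1)) := ⟨by positivity⟩
  have : NeZero (2 ^ (n + 2)) := ⟨by positivity⟩
  have : Nontrivial (Fin (2 ^ (n + 2))) := Fin.nontrivial_iff_two_le.2 (Nat.le_self_pow (by omega) 2)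
  have : Nontrivial (Fin (2 ^ (n + 1)) ⊕ Fin (2 ^ (n + 1))) := ⟨.inl 0, .inr 0, by simp⟩
  have hA : ¬ ((twoCycles n).comap f).Connected := by
    rw [(SimpleGraph.Iso.comap f (twoCycles n)).connected_iff]
    exact SimpleGraph.not_connected_sum
  have hB : ((oneCycle n).comap g).Connected := by
    rw [(SimpleGraph.Iso.comap g (oneCycle n)).connected_iff]
    exact ⟨SimpleGraph.cycleGraph_preconnected⟩
  have hA' := (@models_nonConnected_iff.{u, v, w} L 𝒟 E hc hi _
    (graphStructure E ((twoCycles n).comap f)) _ _ (hrel _)).2 hA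
  have hB' := mt (@models_nonConnected_iff.{u, v, w} L 𝒟 E hc hi _
    (graphStructure E ((oneCycle n).comap g)) _ _ (hrel _)).1 (not_not_intro hB)
  rw [@h _ (graphStructure E ((twoCycles n).comap f)) _] at hA'
  rw [@h _ (graphStructure E ((oneCycle n).comap g)) _] at hB'
  exact hB' ((hn f g).1 hA')

end TeamSemantics

theorem mainTheorem3 (L : FirstOrder.Language.{u, v}) [L.IsRelational]
    (E : L.Relations 2) :
    -- an explicit sentence of `FO(=(·), ⊆₁)` defines non-connectedness of graphs
    (∃ φ : Sent L (Set.range constancy ∪ {unaryInclusion}),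
      φ = nonConnected E (Or.inl ⟨1, rfl⟩) (Or.inr rfl) ∧
      (∀ (M : Type w) [L.Structure M] [Nontrivial M] (G : SimpleGraph M),
        (∀ a b : M, FirstOrder.Language.Structure.RelMap E ![a, b] ↔ G.Adj a b) →
          (Models M φ ↔ ¬ G.Connected)) ∧
      -- and is not equivalent to any sentence of `FO(⊆₁)`
      ∀ ψ : Sent L {unaryInclusion}, ¬ Equivalent.{u, v, w} φ ψ) ∧
    -- no sentence of `FO(⊆₁)` separates pairs of cycles from single cycles
    (¬ ∃ ψ : Sent L {unaryInclusion},
      (∀ n : ℕ, @Models L _ _ (graphStructure E (twoCycles n)) ψ) ∧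
        ∀ n : ℕ, ¬ @Models L _ _ (graphStructure E (oneCycle n)) ψ) ∧
    -- constancy atoms, of all arities or only the unary ones, are not safe for `FO(⊆₁)`
    ¬ Safe.{u, v, w} L (Set.range constancy) {unaryInclusion} ∧
    ¬ Safe.{u, v, w} L {constancy 1} {unaryInclusion} := by
  refine ⟨⟨_, rfl, fun M _ _ G hG => models_nonConnected_iff E _ _ M G hG,
    fun ψ => not_equivalent_nonConnected E _ _ ψ⟩, ?_, ?_, ?_⟩
  · rintro ⟨ψ, hA, hB⟩
    obtain ⟨n, hn⟩ := exists_models_twoCycles_iff_oneCycle.{u, v, 0} E ψ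
    exact hB n ((hn (Equiv.refl _) (Equiv.refl _)).1 (hA n))
  · intro h
    obtain ⟨ψ, hψ⟩ := h (nonConnected E (Or.inl ⟨1, rfl⟩) (Or.inr rfl))
    exact not_equivalent_nonConnected E _ _ ψ hψ
  · intro h
    obtain ⟨ψ, hψ⟩ := h (nonConnected E (Or.inl rfl) (Or.inr rfl))
    exact not_equivalent_nonConnected E _ _ ψ hψ
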